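/- A CNF $F$ over a finite set $V$ of $n$ variables is a finite set of clauses, a clause being a finite set of literals. The incidence graph of $F$ has the variables and the clauses of $F$ as its vertices, a variable being adjacent to a clause if and only if it occurs in it, positively or negatively. An OBDD for $F$ is a rooted directed acyclic graph with two leaves labelled true and false, whose internal nodes are labelled with variables and have two leaving edges, labelled true and false, such that for some fixed linear order of $V$ the labels increase along every path, and such that an assignment satisfies $F$ if and only if the path from the root that follows it ends at the leaf true. Its size is the number of its nodes, leaves included. If the incidence graph of $F$ has treewidth $k$, then $F$ has an OBDD of size $n^{O(k)}$: there is an absolute constant $c$ such that every CNF $F$ with $n$ variables and incidence graph of treewidth $k$ has an OBDD of size at most $c\,n^{ck}$ (with $0^0=1$). Moreover, for every fixed $k\ge 3$ the size is $O(n^k)$: there is a constant $c_k$, depending only on $k$, such that every CNF $F$ with $n$ variables and incidence graph of treewidth $k$ has an OBDD of size at most $c_k\,n^{k}$. -/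

import Mathlib

universe u

namespace SimpleGraph

/-- A tree decomposition of `G` over the finite tree `T`. -/
structure TreeDecomposition {W : Type u} (G : SimpleGraph W) where
  /-- The nodes of the tree. -/
  Node : Type
  [fintypeNode : Fintype Node]
  /-- The tree. -/
  T : SimpleGraph Node
  isTree : T.IsTree
  /-- The bag of each node. -/
  bag : Node → Finset W
  /-- Union: every vertex lies in some bag. -/
  union : ∀ w : W, ∃ t, w ∈ bag t
  /-- Containment: both ends of every edge lie in a common bag. -/
  containment : ∀ w w' : W, G.Adj w w' → ∃ t, w ∈ bag t ∧ w' ∈ bag t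
  /-- Connectedness: the nodes whose bags contain a given vertex induce a subtree. -/
  connectedness : ∀ w : W, (T.induce {t | w ∈ bag t}).IsTree

attribute [instance] TreeDecomposition.fintypeNode

/-- The width: the size of the largest bag, minus one (and `0` if all bags are empty). -/
def TreeDecomposition.width {W : Type u} {G : SimpleGraph W} (D : G.TreeDecomposition) : ℕ :=
  (Finset.univ.sup fun t => (D.bag t).card) - 1

/-- The treewidth of a finite graph: the smallest width of a tree decomposition. For a graph on a
finite vertex type the set below contains the width of the one-bag decomposition. The graph
without vertices gets treewidth `0`. -/
noncomputable def treewidth {W : Type u} (G : SimpleGraph W) : ℕ :=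
  sInf {w : ℕ | ∃ D : G.TreeDecomposition, D.width = w}

end SimpleGraph

/-- A clause over the variables `V`: a finite set of literals, where `(x, true)` is the literal `x`
and `(x, false)` is the literal `¬x`. -/
abbrev Clause (V : Type u) : Type u := Finset (V × Bool)

/-- A CNF over the variables `V`: a finite set of clauses. -/
abbrev CNF (V : Type u) : Type u := Finset (Clause V)

namespace CNF

/-- The truth assignment `σ` satisfies `F`: every clause has a literal that is true under `σ`. -/
def Sat {V : Type u} (F : CNF V) (σ : V → Bool) : Prop :=
  ∀ C ∈ F, ∃ l ∈ C, σ l.1 = l.2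

/-- The variable `x` occurs in the clause `C`, positively or negatively. -/
def Occurs {V : Type u} (x : V) (C : Clause V) : Prop :=
  ∃ b : Bool, (x, b) ∈ C

/-- The incidence graph: the vertices are the variables and the clauses of `F`, and a variable is
adjacent to a clause if and only if it occurs in it. -/
def incidenceGraph {V : Type u} (F : CNF V) : SimpleGraph (V ⊕ {C : Clause V // C ∈ F}) where
  Adj
    | .inl x, .inr C => Occurs x C.1
    | .inr C, .inl x => Occurs x C.1
    | .inl _, .inl _ => False
    | .inr _, .inr _ => False
  symm := ⟨by rintro (x | C) (y | D) h <;> exact h⟩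
  loopless := ⟨by rintro (x | C) h <;> exact h⟩

end CNF

/-- An ordered binary decision diagram over the finite set of variables `V`. The vertices of the
diagram are the internal nodes `.inl v` and the two leaves `.inr true` and `.inr false`. -/
structure OBDD (V : Type u) [Fintype V] where
  /-- The internal nodes. -/
  Node : Type u
  [fintypeNode : Fintype Node]
  /-- The variable that labels an internal node. -/
  label : Node → V
  /-- `child v b` is the head of the edge labelled `b` that leaves `v`. -/
  child : Node → Bool → Node ⊕ Bool
  /-- The root. -/
  root : Node ⊕ Bool
  /-- The permutation of the variables. -/
  order : V ≃ Fin (Fintype.card V)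
  /-- The labels increase along every edge; in particular the diagram is acyclic. -/
  ordered : ∀ (v w : Node) (b : Bool), child v b = .inl w → order (label v) < order (label w)
  /-- Every internal node is reachable from the root, so there is no second root. -/
  reachable : ∀ v : Node,
    Relation.ReflTransGen (fun s t : Node ⊕ Bool => ∃ w b, s = .inl w ∧ t = child w b) root (.inl v)

attribute [instance] OBDD.fintypeNode

namespace OBDD

variable {V : Type u} [Fintype V]

/-- `Z.Leads σ s b`: the computational path that starts at `s` and is consistent with the
assignment `σ` ends at the leaf `b`. -/
inductive Leads (Z : OBDD V) (σ : V → Bool) : Z.Node ⊕ Bool → Bool → Prop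
  | leaf (b : Bool) : Leads Z σ (.inr b) b
  | step (v : Z.Node) (b : Bool) (h : Leads Z σ (Z.child v (σ (Z.label v))) b) :
      Leads Z σ (.inl v) b

/-- `Z` represents `F`: an assignment satisfies `F` if and only if its computational path from the
root ends at the leaf `true`. -/
def Represents (Z : OBDD V) (F : CNF V) : Prop :=
  ∀ σ : V → Bool, Z.Leads σ Z.root true ↔ F.Sat σ

/-- The size: the number of nodes, including the two leaves. -/
def size (Z : OBDD V) : ℕ := Fintype.card Z.Node + 2

end OBDD

/-! For a fixed variable order, the diagram with one node per level and subfunction represents `F`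
(`canonicalOBDD`), so an order with few subfunctions per level is needed. Take a path decomposition
of the incidence graph, that is, a list of bags, and order the variables by their first bag. When
`x` is read next and `Y` is its first bag, the past matters only through the values of the variables
of `Y` already read and the clauses of `Y` already satisfied, plus one state for a falsified clause:
at most `2 ^ |Y| + 1` subfunctions (`ncard_range_subfunction_le`). The size is thus at most twice
the `cost` of the list, plus 2; the number of clauses does not enter.

It remains to refine a tree decomposition of width at most `k`, `k ≥ 3`, by a list of cost at most
`7 * 2 ^ (k + 1) * m ^ k` for `m` variables (`exists_refines_univ`). A centroid `z` has at most `m /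
2` variables beyond each of its edges, those of its bag not counted. Two spines run from `z` into
its two heaviest branches and always continue into the heaviest subbranch. Spine bags are used
unchanged, at total cost at most `2 ^ (k + 1) * m`. A light branch hanging off a spine bag is
treated recursively, without the elements of that bag, which is then added to every bag of the
result at the price of a factor `2 ^ (k + 1)`. By induction a light branch with `w ≤ m / 2`
variables costs at most `Λ * w ^ 3`, where `Λ = 112 * 2 ^ (k + 1) * m ^ (k - 3)`; splitting off the
cube needs `k ≥ 3`. Two inequalities on sums of cubes bound the light branches together by `3 / 56 *
Λ * m ^ 3 = 6 * 2 ^ (k + 1) * m ^ k`, and `6 + 1 = 7` closes the induction. -/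

namespace SimpleGraph

/-! ### Branches of a tree at an edge -/

variable {N : Type*} {T : SimpleGraph N}

/-- The vertices on the side of `v` of the edge `uv`. -/
def branch (T : SimpleGraph N) (u v : N) : Set N :=
  {t | (T.deleteEdges {s(u, v)}).Reachable v t}

theorem mem_branch_self (u v : N) : v ∈ T.branch u v := Reachable.refl _

theorem IsAcyclic.not_mem_branch (hT : T.IsAcyclic) {u v : N} (h : T.Adj u v) :
    u ∉ T.branch u v := fun hu =>
  (isBridge_iff.1 (isAcyclic_iff_forall_isBridge.1 hT (T.mem_edgeSet.2 h))) hu.symm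

theorem IsAcyclic.eq_of_adj_of_mem_branch (hT : T.IsAcyclic) {u v a b : N} (h : T.Adj u v)
    (hab : T.Adj a b) (ha : a ∈ T.branch u v) (hb : b ∉ T.branch u v) : a = v ∧ b = u := by
  by_cases he : s(a, b) = s(u, v)
  · rcases Sym2.eq_iff.1 he with ⟨rfl, rfl⟩ | ⟨rfl, rfl⟩
    · exact absurd ha (hT.not_mem_branch h)
    · exact ⟨rfl, rfl⟩
  · refine absurd (Reachable.trans ha (Adj.reachable ?_)) hb
    rw [deleteEdges_adj]
    exact ⟨hab, he⟩

/-- A walk inside `S` from `a` to `b` has to leave the branch, and the only edge that does so is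
`vu`. -/
theorem IsAcyclic.mem_of_preconnected_of_branch (hT : T.IsAcyclic) {u v a b : N}
    (h : T.Adj u v) {S : Set N} (hS : (T.induce S).Preconnected) (haS : a ∈ S) (hbS : b ∈ S)
    (ha : a ∈ T.branch u v) (hb : b ∉ T.branch u v) : u ∈ S ∧ v ∈ S := by
  obtain ⟨p⟩ := hS ⟨a, haS⟩ ⟨b, hbS⟩
  obtain ⟨d, -, hd₁, hd₂⟩ :=
    p.exists_boundary_dart {t : S | t.1 ∈ T.branch u v} ha hb
  obtain ⟨h₁, h₂⟩ := hT.eq_of_adj_of_mem_branch h (a := d.fst.1) (b := d.snd.1) d.adj hd₁ hd₂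
  exact ⟨h₂ ▸ d.snd.2, h₁ ▸ d.fst.2⟩

theorem IsAcyclic.disjoint_branch_symm (hT : T.IsAcyclic) {u v t : N} (h : T.Adj u v)
    (h₁ : t ∈ T.branch u v) (h₂ : t ∈ T.branch v u) : False := by
  have h₂' : (T.deleteEdges {s(u, v)}).Reachable u t := by
    have := h₂
    rwa [branch, Set.mem_ofPred_eq, Sym2.eq_swap] at this
  exact hT.not_mem_branch h (Reachable.trans h₁ h₂'.symm)

theorem IsAcyclic.branch_subset (hT : T.IsAcyclic) {u v w : N} (h : T.Adj u v) (h' : T.Adj v w)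
    (hne : w ≠ u) : T.branch v w ⊆ T.branch u v := by
  classical
  intro t ht
  by_contra hb
  obtain ⟨p⟩ := ht
  have hw : w ∈ T.branch u v := by
    refine Adj.reachable ?_
    rw [deleteEdges_adj]
    refine ⟨h', fun he => ?_⟩
    rcases Sym2.eq_iff.1 he with ⟨rfl, rfl⟩ | ⟨-, rfl⟩
    · exact h'.ne rfl
    · exact hne rfl
  obtain ⟨d, hd, hd₁, hd₂⟩ := p.exists_boundary_dart (T.branch u v) hw hb
  have hv := (hT.eq_of_adj_of_mem_branch h (deleteEdges_adj.1 d.adj).1 hd₁ hd₂).1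
  have hs := p.dart_fst_mem_support_of_mem_darts hd
  rw [hv] at hs
  exact hT.not_mem_branch h' ⟨p.takeUntil v hs⟩

theorem IsAcyclic.disjoint_branch (hT : T.IsAcyclic) {v w w' t : N} (h : T.Adj v w)
    (h' : T.Adj v w') (hne : w ≠ w') (h₁ : t ∈ T.branch v w) (h₂ : t ∈ T.branch v w') : False :=
  hT.disjoint_branch_symm h h₁ (hT.branch_subset h.symm h' hne.symm h₂)

theorem Connected.exists_mem_branch (hT : T.Connected) {v t : N} (hne : t ≠ v) :
    ∃ w, T.Adj v w ∧ t ∈ T.branch v w := by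
  classical
  obtain ⟨p, hp⟩ := (hT.preconnected v t).exists_isPath
  cases p with
  | nil => exact absurd rfl hne
  | @cons _ w _ h p =>
    rw [Walk.cons_isPath_iff] at hp
    refine ⟨w, h, ⟨p.toDeleteEdges _ fun e he he' => ?_⟩⟩
    obtain rfl : e = s(v, w) := he'
    exact hp.2 (p.fst_mem_support_of_mem_edges he)

end SimpleGraph

/-! ### Lists of bags and their cost -/

namespace BagList

open Finset

open scoped Classical in
/-- The union of a list of bags. -/
noncomputable def support {W : Type*} : List (Finset W) → Finset W
  | [] => ∅
  | Y :: L => Y ∪ support L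

open scoped Classical in
/-- The first bag that contains `x`, and `∅` if there is none. -/
noncomputable def first {W : Type*} : List (Finset W) → W → Finset W
  | [], _ => ∅
  | Y :: L, x => if x ∈ Y then Y else first L x

/-- Every element occurs in consecutive bags. -/
def Conv {W : Type*} (L : List (Finset W)) : Prop :=
  ∀ L₁ Y L₂, L = L₁ ++ Y :: L₂ → ∀ w, w ∈ support L₁ → w ∈ support L₂ → w ∈ Y

/-- `w` lies in the first bag of `L`. -/
def InHead {W : Type*} (L : List (Finset W)) (w : W) : Prop :=
  ∃ Y L', L = Y :: L' ∧ w ∈ Y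

/-- `w` lies in the last bag of `L`. -/
def InLast {W : Type*} (L : List (Finset W)) (w : W) : Prop :=
  ∃ L' Y, L = L' ++ [Y] ∧ w ∈ Y

open scoped Classical in
/-- The sum of `2 ^ |Y|` over the elements `x` of `Q`, where `Y` is the first bag with `x ∈ Y`. -/
noncomputable def cost {W : Type*} (Q : Finset W) (L : List (Finset W)) : ℕ :=
  ∑ x ∈ Q ∩ support L, 2 ^ (first L x).card

variable {W : Type*} {L L₁ L₂ : List (Finset W)} {Q Y Z : Finset W} {w x : W}

@[simp] theorem support_nil : support ([] : List (Finset W)) = ∅ := rfl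

open scoped Classical in
@[simp] theorem support_cons : support (Y :: L) = Y ∪ support L := rfl

open scoped Classical in
@[simp] theorem support_append : support (L₁ ++ L₂) = support L₁ ∪ support L₂ := by
  induction L₁ with
  | nil => simp
  | cons Y L ih => simp [ih, union_assoc]

theorem mem_support : w ∈ support L ↔ ∃ Y ∈ L, w ∈ Y := by
  induction L with
  | nil => simp
  | cons Y L ih => simp [ih]

theorem InLast.mem_support (h : InLast L w) : w ∈ support L := by
  obtain ⟨L', Y, rfl, hw⟩ := h
  simp [hw]

theorem InLast.append (h : InLast L₂ w) : InLast (L₁ ++ L₂) w := by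
  obtain ⟨L', Y, rfl, hw⟩ := h
  exact ⟨L₁ ++ L', Y, by simp, hw⟩

theorem inLast_singleton (h : w ∈ Y) : InLast [Y] w := ⟨[], Y, rfl, h⟩

open scoped Classical in
theorem support_map_union (L : List (Finset W)) (Z : Finset W) :
    support (L.map (· ∪ Z)) ⊆ support L ∪ Z := by
  induction L with
  | nil => simp
  | cons Y L ih =>
    intro w hw
    have := @ih w
    simp only [List.map_cons, support_cons, mem_union] at *
    tauto

open scoped Classical in
theorem first_append : first (L₁ ++ L₂) x = if x ∈ support L₁ then first L₁ x else first L₂ x := by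
  induction L₁ with
  | nil => simp
  | cons Y L ih =>
    by_cases h : x ∈ Y <;> simp [first, h, ih]

open scoped Classical in
theorem first_map_union (hx : x ∈ support L) (hZ : x ∉ Z) :
    first (L.map (· ∪ Z)) x = first L x ∪ Z := by
  induction L with
  | nil => simp at hx
  | cons Y L ih =>
    by_cases h : x ∈ Y
    · simp [first, h]
    · have : x ∈ support L := by simpa [h] using hx
      simp [first, h, hZ, ih this]

theorem exists_split_first (hx : x ∈ support L) :
    ∃ L₁ L₂, L = L₁ ++ first L x :: L₂ ∧ x ∉ support L₁ ∧ x ∈ first L x := by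
  induction L with
  | nil => simp at hx
  | cons Y L ih =>
    by_cases h : x ∈ Y
    · exact ⟨[], L, by simp [first, h], by simp, by simp [first, h]⟩
    · obtain ⟨L₁, L₂, h₁, h₂, h₃⟩ := ih (by simpa [h] using hx)
      refine ⟨Y :: L₁, L₂, ?_, by simp [h, h₂], by simpa [first, h] using h₃⟩
      rw [first, if_neg h, List.cons_append, ← h₁]

-- Elements are charged at their first bag only, so the second list pays just for what the first has
-- not met.
open scoped Classical in
theorem cost_append :
    cost Q (L₁ ++ L₂) = cost Q L₁ + cost (Q \ support L₁) L₂ := by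
  have hs : Q ∩ support (L₁ ++ L₂) = (Q ∩ support L₁) ∪ ((Q \ support L₁) ∩ support L₂) := by
    ext x
    simp only [support_append, mem_inter, mem_union, mem_sdiff]
    tauto
  rw [cost, hs, sum_union]
  · refine congrArg₂ _ (sum_congr rfl fun x hx => ?_) (sum_congr rfl fun x hx => ?_)
    · rw [first_append, if_pos (mem_inter.1 hx).2]
    · rw [first_append, if_neg (mem_sdiff.1 (mem_inter.1 hx).1).2]
  · rw [disjoint_left]
    intro x hx hx'
    exact (mem_sdiff.1 (mem_inter.1 hx').1).2 (mem_inter.1 hx).2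

theorem cost_mono {Q' : Finset W} (h : Q' ⊆ Q) : cost Q' L ≤ cost Q L :=
  sum_le_sum_of_subset (by gcongr)

@[simp] theorem cost_nil : cost Q [] = 0 := by simp [cost]

open scoped Classical in
theorem cost_singleton : cost Q [Y] = (Q ∩ Y).card * 2 ^ Y.card := by
  have : ∀ x ∈ Q ∩ support [Y], 2 ^ (first [Y] x).card = 2 ^ Y.card := by
    intro x hx
    have : x ∈ Y := by simpa using (mem_inter.1 hx).2
    simp [first, this]
  rw [cost, sum_congr rfl this]
  simp

open scoped Classical in
theorem cost_map_union (h : Disjoint Q Z) :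
    cost Q (L.map (· ∪ Z)) ≤ 2 ^ Z.card * cost Q L := by
  rw [cost, cost, mul_sum]
  have hd : ∀ x ∈ Q, x ∉ Z := fun x hx => disjoint_left.1 h hx
  have hs : Q ∩ support (L.map (· ∪ Z)) ⊆ Q ∩ support L := by
    intro x hx
    have h₁ := (mem_inter.1 hx).1
    exact mem_inter.2 ⟨h₁, (mem_union.1 (support_map_union L Z (mem_inter.1 hx).2)).resolve_right
      (hd x h₁)⟩
  refine (sum_le_sum_of_subset hs).trans (sum_le_sum fun x hx => ?_)
  rw [first_map_union (mem_inter.1 hx).2 (hd x (mem_inter.1 hx).1), ← pow_add]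
  refine Nat.pow_le_pow_right two_pos ((card_union_le _ _).trans_eq (add_comm _ _))

theorem conv_nil : Conv ([] : List (Finset W)) := by
  intro L₁ Y L₂ h
  simp at h

theorem conv_singleton (Y : Finset W) : Conv [Y] := by
  intro L₁ Z L₂ h w h₁
  cases L₁ with
  | nil => simp at h₁
  | cons => simp at h

theorem Conv.append (h₁ : Conv L₁) (h₂ : Conv L₂)
    (h : ∀ w, w ∈ support L₁ → w ∈ support L₂ → InLast L₁ w ∧ InHead L₂ w) :
    Conv (L₁ ++ L₂) := by
  classical
  intro M₁ Y M₂ he w hw₁ hw₂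
  rcases List.append_eq_append_iff.1 he with ⟨as, rfl, hL⟩ | ⟨cs, hL, hM⟩
  · rw [support_append, mem_union] at hw₁
    rcases hw₁ with hw₁ | hw₁
    · obtain ⟨-, Z, L', hZ, hw⟩ := h w hw₁ (by rw [hL]; simp [hw₂])
      rw [hZ] at hL
      cases as with
      | nil => simp only [List.nil_append, List.cons.injEq] at hL; exact hL.1 ▸ hw
      | cons A as =>
        simp only [List.cons_append, List.cons.injEq] at hL
        refine h₂ (A :: as) Y M₂ (by rw [hZ, hL.1, hL.2]; rfl) w ?_ hw₂
        simp [← hL.1, hw]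
    · exact h₂ as Y M₂ hL w hw₁ hw₂
  · cases cs with
    | nil =>
      simp only [List.nil_append] at hM
      simp only [List.append_nil] at hL
      subst hL
      obtain ⟨-, Z, L', hZ, hw⟩ := h w hw₁ (by rw [← hM]; simp [hw₂])
      rw [hZ] at hM
      exact (List.cons.inj hM).1 ▸ hw
    | cons A cs =>
      simp only [List.cons_append, List.cons.injEq] at hM
      obtain ⟨rfl, rfl⟩ := hM
      rw [support_append, mem_union] at hw₂
      rcases hw₂ with hw₂ | hw₂
      · exact h₁ M₁ Y cs hL w hw₁ hw₂
      · obtain ⟨⟨L', Z, hZ, hw⟩, -⟩ := h w (by rw [hL]; simp [hw₁]) hw₂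
        rcases List.eq_nil_or_concat cs with rfl | ⟨cs', A, rfl⟩
        · rw [hL] at hZ
          exact (List.append_inj' hZ rfl).2 |> fun e => (List.cons.inj e).1 ▸ hw
        · refine h₁ M₁ Y _ hL w hw₁ ?_
          have : M₁ ++ Y :: cs' ++ [A] = L' ++ [Z] := by rw [← hZ, hL]; simp
          have hA := (List.cons.inj (List.append_inj' this rfl).2).1
          simp [hA, hw]

open scoped Classical in
theorem Conv.map_union (h : Conv L) (Z : Finset W) : Conv (L.map (· ∪ Z)) := by
  intro M₁ Y M₂ he w hw₁ hw₂
  obtain ⟨L₁, L₂', rfl, rfl, h₂⟩ := List.map_eq_append_iff.1 he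
  obtain ⟨Y', L₂, rfl, rfl, rfl⟩ := List.map_eq_cons_iff.1 h₂
  rw [mem_union]
  by_cases hZ : w ∈ Z
  · exact Or.inr hZ
  · exact Or.inl (h L₁ Y' L₂ rfl w
      ((mem_union.1 (support_map_union _ _ hw₁)).resolve_right hZ)
      ((mem_union.1 (support_map_union _ _ hw₂)).resolve_right hZ))

end BagList

/-! ### Gluing path decompositions at a node -/

namespace BagList

open Finset SimpleGraph

open scoped Classical

section

variable {N W : Type*} {T : SimpleGraph N} {B : N → Finset W} {Q : Finset W}

/-- An element of bags on both sides of an edge lies in the bags of both ends of the edge. -/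
def Separates (T : SimpleGraph N) (B : N → Finset W) : Prop :=
  ∀ ⦃u v⦄, T.Adj u v → ∀ ⦃a b w⦄, a ∈ T.branch u v → b ∉ T.branch u v → w ∈ B a → w ∈ B b →
    w ∈ B u ∧ w ∈ B v

/-- The elements of `Q` that occur in bags beyond the edge `uv`, but not in the bag of `u`. -/
noncomputable def beyond (T : SimpleGraph N) (B : N → Finset W) (Q : Finset W) (u v : N) :
    Finset W :=
  {x ∈ Q | x ∉ B u ∧ ∃ t ∈ T.branch u v, x ∈ B t}

/-- The elements of `Q` that occur in some bag. -/
noncomputable def occurring (B : N → Finset W) (Q : Finset W) : Finset W :=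
  {x ∈ Q | ∃ t, x ∈ B t}

/-- The bags beyond the edge `uv` without the elements of the bag of `u`. -/
noncomputable def residual (T : SimpleGraph N) (B : N → Finset W) (u v : N) (t : N) : Finset W :=
  if t ∈ T.branch u v then B t \ B u else ∅

/-- `L` is a path decomposition that refines the bags of the nodes in `S`. -/
structure Refines (B : N → Finset W) (S : Set N) (L : List (Finset W)) : Prop where
  conv : Conv L
  exists_mem : ∀ w ∈ support L, ∃ t ∈ S, w ∈ B t
  cover : ∀ t ∈ S, ∃ Y ∈ L, B t ⊆ Y

/-- The cost of `L` is at most `K` for each element of `Q`, plus `G`. -/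
def CostLE (Q : Finset W) (K G : ℕ) (L : List (Finset W)) : Prop :=
  ∀ Q' ⊆ Q, cost Q' L ≤ K * (Q' ∩ support L).card + G

theorem mem_beyond {u v : N} {x : W} :
    x ∈ beyond T B Q u v ↔ x ∈ Q ∧ x ∉ B u ∧ ∃ t ∈ T.branch u v, x ∈ B t :=
  mem_filter

theorem mem_occurring {x : W} : x ∈ occurring B Q ↔ x ∈ Q ∧ ∃ t, x ∈ B t :=
  mem_filter

theorem mem_residual {u v t : N} {w : W} :
    w ∈ residual T B u v t ↔ t ∈ T.branch u v ∧ w ∈ B t ∧ w ∉ B u := by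
  unfold residual
  split_ifs with h <;> simp [h]

/-- An element beyond `pq` that is not in the bag of `p` occurs only beyond `pq`, so emptying the
other bags loses none of its occurrences. The recursion can thus stay on the same tree. -/
theorem Separates.residual (hB : Separates T B) {p q : N} (hpq : T.Adj p q) :
    Separates T (residual T B p q) := by
  intro u v huv a b w ha hb hwa hwb
  rw [mem_residual] at hwa hwb
  obtain ⟨hu, hv⟩ := hB huv ha hb hwa.2.1 hwb.2.1
  have key : ∀ t, w ∈ B t → t ∈ T.branch p q := fun t ht => by
    by_contra h
    exact hwa.2.2 (hB hpq hwa.1 h hwa.2.1 ht).1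
  exact ⟨mem_residual.2 ⟨key u hu, hu, hwa.2.2⟩, mem_residual.2 ⟨key v hv, hv, hwa.2.2⟩⟩

theorem refines_empty : Refines B ∅ [] := ⟨conv_nil, by simp, by simp⟩

/-- Since the bag of `z` is added to every bag of the light branches, its elements persist to the
end, and consecutive branches share nothing else. -/
theorem exists_refines_append_branches (hB : Separates T B) {z : N} {Λ : ℕ}
    {S : Finset N} (hS : ∀ c ∈ S, T.Adj z c) (hT : T.IsAcyclic)
    (hrec : ∀ c ∈ S, ∃ L, Refines (residual T B z c) Set.univ L ∧
      2 ^ (B z).card * cost Q L ≤ Λ * (beyond T B Q z c).card ^ 3)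
    {S₀ : Set N} {M : List (Finset W)} (hM : Refines B S₀ M) (hlast : ∀ w ∈ B z, InLast M w)
    (hdisj : ∀ c ∈ S, ∀ t ∈ S₀, t ∉ T.branch z c) :
    ∃ H, Refines B (S₀ ∪ ⋃ c ∈ S, T.branch z c) (M ++ H) ∧ (∀ w ∈ B z, InLast (M ++ H) w) ∧
      ∀ Q' ⊆ Q, cost Q' (M ++ H) ≤ cost Q' M + Λ * ∑ c ∈ S, (beyond T B Q z c).card ^ 3 := by
  induction S using Finset.induction_on with
  | empty => exact ⟨[], by simpa using hM, by simpa using hlast, by simp⟩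
  | insert c S hc ih =>
    obtain ⟨H, hH, hHl, hHc⟩ := ih (fun d hd => hS d (mem_insert_of_mem hd))
      (fun d hd => hrec d (mem_insert_of_mem hd)) (fun d hd => hdisj d (mem_insert_of_mem hd))
    obtain ⟨L, hL, hLc⟩ := hrec c (mem_insert_self _ _)
    have hzc := hS c (mem_insert_self _ _)
    have hout : ∀ t ∈ S₀ ∪ ⋃ c ∈ S, T.branch z c, t ∉ T.branch z c := by
      rintro t (ht | ht) htc
      · exact hdisj c (mem_insert_self _ _) t ht htc
      · obtain ⟨d, hd, htd⟩ := Set.mem_iUnion₂.1 ht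
        exact hT.disjoint_branch hzc (hS d (mem_insert_of_mem hd)) (by rintro rfl; exact hc hd)
          htc htd
    have hlz : ∀ w ∈ support (L.map (· ∪ B z)), w ∈ support (M ++ H) → w ∈ B z := by
      intro w hw hw'
      by_contra hwz
      have hwL := (mem_union.1 (support_map_union _ _ hw)).resolve_right hwz
      obtain ⟨t, -, ht⟩ := hL.exists_mem w hwL
      obtain ⟨t', ht', hwt'⟩ := hH.exists_mem w hw'
      rw [mem_residual] at ht
      exact hwz (hB hzc ht.1 (hout t' ht') ht.2.1 hwt').1
    refine ⟨H ++ L.map (· ∪ B z), ⟨?_, ?_, ?_⟩, ?_, ?_⟩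
    · rw [← List.append_assoc]
      refine hH.conv.append (hL.conv.map_union _) fun w hw hw' => ?_
      have hwz := hlz w hw' hw
      refine ⟨hHl w hwz, ?_⟩
      cases L with
      | nil => simp at hw'
      | cons Y L => exact ⟨_, _, rfl, mem_union_right _ hwz⟩
    · intro w hw
      rw [← List.append_assoc, support_append, mem_union] at hw
      by_cases hwM : w ∈ support (M ++ H)
      · obtain ⟨t, ht, hwt⟩ := hH.exists_mem w hwM
        refine ⟨t, ?_, hwt⟩
        rcases ht with ht | ht
        · exact Or.inl ht
        · right
          obtain ⟨d, hd, htd⟩ := Set.mem_iUnion₂.1 ht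
          exact Set.mem_iUnion₂.2 ⟨d, mem_insert_of_mem hd, htd⟩
      · have hw' := hw.resolve_left hwM
        have hwz : w ∉ B z := fun h => hwM (hHl w h).mem_support
        obtain ⟨t, -, ht⟩ := hL.exists_mem w
          ((mem_union.1 (support_map_union _ _ hw')).resolve_right hwz)
        rw [mem_residual] at ht
        exact ⟨t, Or.inr (Set.mem_iUnion₂.2 ⟨c, mem_insert_self _ _, ht.1⟩), ht.2.1⟩
    · intro t ht
      rw [← List.append_assoc]
      by_cases htc : t ∈ T.branch z c
      · obtain ⟨Y, hY, htY⟩ := hL.cover t trivial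
        refine ⟨Y ∪ B z, List.mem_append_right _ (List.mem_map_of_mem hY), fun w hw => ?_⟩
        by_cases hwz : w ∈ B z
        · exact mem_union_right _ hwz
        · exact mem_union_left _ (htY (mem_residual.2 ⟨htc, hw, hwz⟩))
      · obtain ⟨Y, hY, htY⟩ := hH.cover t (by
          rcases ht with ht | ht
          · exact Or.inl ht
          · obtain ⟨d, hd, htd⟩ := Set.mem_iUnion₂.1 ht
            rcases mem_insert.1 hd with rfl | hd
            · exact absurd htd htc
            · exact Or.inr (Set.mem_iUnion₂.2 ⟨d, hd, htd⟩))
        exact ⟨Y, List.mem_append_left _ hY, htY⟩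
    · intro w hw
      rw [← List.append_assoc]
      rcases List.eq_nil_or_concat L with rfl | ⟨L', A, rfl⟩
      · simpa using hHl w hw
      · exact InLast.append ⟨L'.map (· ∪ B z), A ∪ B z, by simp, mem_union_right _ hw⟩
    · intro Q' hQ'
      rw [← List.append_assoc, cost_append, sum_insert hc]
      have h₁ := hHc Q' hQ'
      -- The elements of the bag of `z` have been charged in `M` already; only the others pay the
      -- factor `2 ^ (B z).card`.
      have hd : Disjoint (Q' \ support (M ++ H)) (B z) := by
        rw [Finset.disjoint_left]
        intro w hw hwz
        exact (mem_sdiff.1 hw).2 (hHl w hwz).mem_support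
      have h₂ := cost_map_union (L := L) hd
      have h₃ : cost (Q' \ support (M ++ H)) L ≤ cost Q L :=
        cost_mono (sdiff_subset.trans hQ')
      have h₄ := Nat.mul_le_mul_left (2 ^ (B z).card) h₃
      rw [mul_add]
      omega

/-- The list is `L₁`, the bag of `z`, the light branches with that bag added, then `L₂`. With `L₁`
or `L₂` empty it extends a spine by one node; with both present it joins two spines at the centroid.
-/
theorem exists_refines_glue (hB : Separates T B) {z : N} {Λ K G₁ G₂ : ℕ} {S : Finset N}
    (hT : T.IsAcyclic) (hS : ∀ c ∈ S, T.Adj z c)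
    (hrec : ∀ c ∈ S, ∃ L, Refines (residual T B z c) Set.univ L ∧
      2 ^ (B z).card * cost Q L ≤ Λ * (beyond T B Q z c).card ^ 3)
    (hK : 2 ^ (B z).card ≤ K) {N₁ N₂ : Set N} {L₁ L₂ : List (Finset W)}
    (h₁ : Refines B N₁ L₁) (h₂ : Refines B N₂ L₂)
    (hl : ∀ w ∈ support L₁, w ∈ B z → InLast L₁ w)
    (hh : ∀ w ∈ support L₂, w ∈ B z → InHead L₂ w)
    (hs₁ : ∀ t ∈ N₁, ∀ t' ∉ N₁, ∀ w ∈ B t, w ∈ B t' → w ∈ B z)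
    (hs₂ : ∀ t ∈ N₂, ∀ t' ∉ N₂, ∀ w ∈ B t, w ∈ B t' → w ∈ B z)
    (hz₂ : z ∉ N₂) (hd : ∀ t ∈ N₁, t ∉ N₂)
    (hd₁ : ∀ c ∈ S, ∀ t ∈ N₁, t ∉ T.branch z c) (hd₂ : ∀ c ∈ S, ∀ t ∈ N₂, t ∉ T.branch z c)
    (hc₁ : CostLE Q K G₁ L₁) (hc₂ : CostLE Q K G₂ L₂) :
    ∃ M, Refines B (N₁ ∪ {z} ∪ (⋃ c ∈ S, T.branch z c) ∪ N₂) M ∧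
      (L₁ = [] → ∀ w ∈ B z, InHead M w) ∧ (L₂ = [] → ∀ w ∈ B z, InLast M w) ∧
      CostLE Q K (G₁ + G₂ + Λ * ∑ c ∈ S, (beyond T B Q z c).card ^ 3) M := by
  have hM : Refines B (N₁ ∪ {z}) (L₁ ++ [B z]) := by
    refine ⟨h₁.conv.append (conv_singleton _) fun w hw hw' => ?_, ?_, ?_⟩
    · have hwz : w ∈ B z := by simpa using hw'
      exact ⟨hl w hw hwz, _, _, rfl, hwz⟩
    · intro w hw
      rw [support_append, mem_union] at hw
      rcases hw with hw | hw
      · obtain ⟨t, ht, hwt⟩ := h₁.exists_mem w hw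
        exact ⟨t, Or.inl ht, hwt⟩
      · exact ⟨z, Or.inr rfl, by simpa using hw⟩
    · rintro t (ht | rfl)
      · obtain ⟨Y, hY, htY⟩ := h₁.cover t ht
        exact ⟨Y, List.mem_append_left _ hY, htY⟩
      · exact ⟨B t, by simp, subset_rfl⟩
  obtain ⟨H, hH, hHl, hHc⟩ := exists_refines_append_branches hB hS hT hrec hM
    (fun w hw => (inLast_singleton hw).append) (by
      rintro c hc t (ht | rfl)
      · exact hd₁ c hc t ht
      · exact hT.not_mem_branch (hS c hc))
  set M := L₁ ++ [B z] ++ H with hMdef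
  have hout : ∀ t ∈ N₁ ∪ {z} ∪ ⋃ c ∈ S, T.branch z c, t ∉ N₂ := by
    rintro t ((ht | rfl) | ht) ht₂
    · exact hd t ht ht₂
    · exact hz₂ ht₂
    · obtain ⟨c, hc, htc⟩ := Set.mem_iUnion₂.1 ht
      exact hd₂ c hc t ht₂ htc
  refine ⟨M ++ L₂, ⟨?_, ?_, ?_⟩, ?_, ?_, ?_⟩
  · refine hH.conv.append h₂.conv fun w hw hw' => ?_
    obtain ⟨t, ht, hwt⟩ := hH.exists_mem w hw
    obtain ⟨t', ht', hwt'⟩ := h₂.exists_mem w hw'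
    have hwz := hs₂ t' ht' t (hout t ht) w hwt' hwt
    exact ⟨hHl w hwz, hh w hw' hwz⟩
  · intro w hw
    rw [support_append, mem_union] at hw
    rcases hw with hw | hw
    · obtain ⟨t, ht, hwt⟩ := hH.exists_mem w hw
      exact ⟨t, Or.inl ht, hwt⟩
    · obtain ⟨t, ht, hwt⟩ := h₂.exists_mem w hw
      exact ⟨t, Or.inr ht, hwt⟩
  · rintro t (ht | ht)
    · obtain ⟨Y, hY, htY⟩ := hH.cover t ht
      exact ⟨Y, List.mem_append_left _ hY, htY⟩
    · obtain ⟨Y, hY, htY⟩ := h₂.cover t ht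
      exact ⟨Y, List.mem_append_right _ hY, htY⟩
  · rintro rfl w hw
    exact ⟨B z, H ++ L₂, by simp [hMdef], hw⟩
  · rintro rfl w hw
    simpa using hHl w hw
  · intro Q' hQ'
    have e₁ := hHc Q' hQ'
    have e₂ := hc₁ Q' hQ'
    have e₃ := hc₂ (Q' \ support M) (sdiff_subset.trans hQ')
    have e₄ : cost (Q' \ support L₁) [B z] ≤ K * ((Q' \ support L₁) ∩ B z).card := by
      rw [cost_singleton, mul_comm]
      exact Nat.mul_le_mul_right _ hK
    -- The three parts charge disjoint sets of elements, so the terms with factor `K` add up without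
    -- overlap.
    have e₅ : (Q' ∩ support L₁).card + ((Q' \ support L₁) ∩ B z).card +
        ((Q' \ support M) ∩ support L₂).card ≤ (Q' ∩ support (M ++ L₂)).card := by
      rw [← card_union_of_disjoint, ← card_union_of_disjoint]
      · refine card_le_card fun w hw => ?_
        simp only [hMdef, support_append, support_cons, support_nil, mem_union, mem_inter,
          mem_sdiff] at hw ⊢
        tauto
      · rw [Finset.disjoint_left]
        intro w hw hw'
        simp only [hMdef, support_append, support_cons, support_nil, mem_union, mem_inter,
          mem_sdiff] at hw hw'
        tauto
      · rw [Finset.disjoint_left]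
        intro w hw hw'
        simp only [mem_inter, mem_sdiff] at hw hw'
        tauto
    have e₆ := Nat.mul_le_mul_left K e₅
    have e₇ := cost_append (Q := Q') (L₁ := L₁) (L₂ := [B z])
    rw [cost_append]
    simp only [mul_add] at e₆
    omega

end

end BagList

/-! ### Spines and the centroid -/

namespace BagList

open Finset SimpleGraph

open scoped Classical

section

variable {N W : Type*} {T : SimpleGraph N} {B : N → Finset W} {Q : Finset W}

theorem beyond_disjoint (hB : Separates T B) (hT : T.IsAcyclic) {v c d : N}
    (hc : T.Adj v c) (hd : T.Adj v d) (hne : c ≠ d) :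
    Disjoint (beyond T B Q v c) (beyond T B Q v d) := by
  rw [Finset.disjoint_left]
  intro x hx hx'
  obtain ⟨-, hxv, t, ht, hxt⟩ := mem_beyond.1 hx
  obtain ⟨-, -, t', ht', hxt'⟩ := mem_beyond.1 hx'
  exact hxv (hB hc ht (fun h => hT.disjoint_branch hc hd hne h ht') hxt hxt').1

theorem sum_card_beyond_le (hB : Separates T B) (hT : T.IsAcyclic) {v : N} {S : Finset N}
    (hS : ∀ c ∈ S, T.Adj v c) {R : Finset W} (hR : ∀ c ∈ S, beyond T B Q v c ⊆ R) :
    ∑ c ∈ S, (beyond T B Q v c).card ≤ R.card := by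
  rw [← card_biUnion fun c hc d hd hne => beyond_disjoint hB hT (hS c hc) (hS d hd) hne]
  exact card_le_card (biUnion_subset.2 hR)

theorem beyond_subset (hB : Separates T B) (hT : T.IsAcyclic) {u v c : N} (h : T.Adj u v)
    (hc : T.Adj v c) (hne : c ≠ u) : beyond T B Q v c ⊆ beyond T B Q u v := by
  intro x hx
  obtain ⟨hxQ, hxv, t, ht, hxt⟩ := mem_beyond.1 hx
  refine mem_beyond.2 ⟨hxQ, fun hxu => ?_, t, hT.branch_subset h hc hne ht, hxt⟩
  refine hxv (hB hc ht (fun hu => ?_) hxt hxu).1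
  exact hT.not_mem_branch h (hT.branch_subset h hc hne hu)

theorem card_beyond_add_card_beyond_le (hB : Separates T B) (hT : T.IsAcyclic) {u v : N}
    (h : T.Adj u v) {m : ℕ} (hm : (occurring B Q).card ≤ m) :
    (beyond T B Q u v).card + (beyond T B Q v u).card ≤ m := by
  rw [← card_union_of_disjoint]
  · refine (card_le_card fun x hx => ?_).trans hm
    rcases mem_union.1 hx with hx | hx <;>
    · obtain ⟨hxQ, -, t, -, hxt⟩ := mem_beyond.1 hx
      exact mem_occurring.2 ⟨hxQ, t, hxt⟩
  · rw [Finset.disjoint_left]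
    intro x hx hx'
    obtain ⟨-, hxu, t, ht, hxt⟩ := mem_beyond.1 hx
    obtain ⟨-, -, t', ht', hxt'⟩ := mem_beyond.1 hx'
    exact hxu (hB h ht (fun h' => hT.disjoint_branch_symm h h' ht') hxt hxt').1

/-- If `x ≤ b`, then `(b + x) ^ 3 - b ^ 3 = 3 * b ^ 2 * x + 3 * b * x ^ 2 + x ^ 3 ≥ 7 * x ^ 3`. -/
theorem cube_add_seven_mul_sum_cube_le {ι : Type*} (S : Finset ι) (f : ι → ℕ) (a : ℕ)
    (h : ∀ i ∈ S, f i ≤ a) : a ^ 3 + 7 * ∑ i ∈ S, f i ^ 3 ≤ (a + ∑ i ∈ S, f i) ^ 3 := by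
  induction S using Finset.induction_on with
  | empty => simp
  | insert i S hi ih =>
    have h₁ := ih fun j hj => h j (mem_insert_of_mem hj)
    have h₂ : f i ≤ a + ∑ i ∈ S, f i := (h i (mem_insert_self _ _)).trans (Nat.le_add_right _ _)
    rw [sum_insert hi, sum_insert hi]
    generalize ∑ i ∈ S, f i ^ 3 = s at *
    rw [show a + (f i + ∑ i ∈ S, f i) = (a + ∑ i ∈ S, f i) + f i by ring]
    generalize a + ∑ i ∈ S, f i = b at *
    generalize f i = x at *
    obtain ⟨d, rfl⟩ := Nat.exists_eq_add_of_le h₂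
    nlinarith [Nat.zero_le (x ^ 2 * d), Nat.zero_le (x * d ^ 2)]

/-- A spine into the branch; `G` is the cost of the light branches hanging off it. Both orientations
are built because reversing a list changes the first bags and hence the cost. -/
theorem exists_refines_branch [Fintype N] (hT : T.IsTree) (hB : Separates T B) {Λ K m : ℕ}
    (hK : ∀ t, 2 ^ (B t).card ≤ K)
    (hrec : ∀ z c, T.Adj z c → 2 * (beyond T B Q z c).card ≤ m →
      ∃ L, Refines (residual T B z c) Set.univ L ∧
        2 ^ (B z).card * cost Q L ≤ Λ * (beyond T B Q z c).card ^ 3)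
    {u v : N} (h : T.Adj u v) (hm : 2 * (beyond T B Q u v).card ≤ m) :
    ∃ G, 7 * G ≤ Λ * (beyond T B Q u v).card ^ 3 ∧
      (∃ L, Refines B (T.branch u v) L ∧ (∀ w ∈ B v, InLast L w) ∧ CostLE Q K G L) ∧
      (∃ L, Refines B (T.branch u v) L ∧ (∀ w ∈ B v, InHead L w) ∧ CostLE Q K G L) := by
  have hA := hT.isAcyclic
  induction hn : (T.branch u v).ncard using Nat.strong_induction_on generalizing u v with
  | _ n ih =>
  set S : Finset N := {c | T.Adj v c ∧ c ≠ u}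
  have hS : ∀ c ∈ S, T.Adj v c ∧ c ≠ u := fun c hc => (mem_filter.1 hc).2
  have hbr : ∀ t, t ∈ T.branch u v ↔ t = v ∨ ∃ c ∈ S, t ∈ T.branch v c := by
    intro t
    constructor
    · intro ht
      by_cases htv : t = v
      · exact Or.inl htv
      · obtain ⟨c, hc, htc⟩ := hT.connected.exists_mem_branch htv
        refine Or.inr ⟨c, mem_filter.2 ⟨mem_univ _, hc, ?_⟩, htc⟩
        rintro rfl
        exact hA.disjoint_branch_symm h ht htc
    · rintro (rfl | ⟨c, hc, htc⟩)
      · exact mem_branch_self _ _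
      · exact hA.branch_subset h (hS c hc).1 (hS c hc).2 htc
  have hle : ∀ c ∈ S, 2 * (beyond T B Q v c).card ≤ m := fun c hc =>
    (Nat.mul_le_mul_left _ (card_le_card (beyond_subset hB hA h (hS c hc).1 (hS c hc).2))).trans hm
  have hnil : CostLE Q K 0 ([] : List (Finset W)) := by intro Q' _; simp
  rcases S.eq_empty_or_nonempty with hSe | hSn
  · have hv : T.branch u v = ∅ ∪ {v} ∪ (⋃ c ∈ (∅ : Finset N), T.branch v c) ∪ ∅ := by
      ext t
      rw [hbr, hSe]
      simp
    obtain ⟨M, hM, hMh, hMl, hMc⟩ := exists_refines_glue (S := ∅) (z := v) (Λ := Λ) hB hA (by simp)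
      (by simp) (hK v) (refines_empty (B := B)) refines_empty (by simp) (by simp) (by simp)
      (by simp) (by simp) (by simp) (by simp) (by simp) hnil hnil
    rw [← hv] at hM
    exact ⟨0, by simp, ⟨M, hM, hMl rfl, by simpa using hMc⟩, ⟨M, hM, hMh rfl, by simpa using hMc⟩⟩
  -- The spine continues into the heaviest subbranch `d`, which pays no factor; the others are
  -- light.
  obtain ⟨d, hd, hmax⟩ := S.exists_max_image (fun c => (beyond T B Q v c).card) hSn
  have hvd := (hS d hd).1
  obtain ⟨G, hG, ⟨L, hL, hLl, hLc⟩, ⟨R, hR, hRh, hRc⟩⟩ := ih _ (by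
    rw [← hn]
    refine Set.ncard_lt_ncard ⟨hA.branch_subset h hvd (hS d hd).2, fun hsub => ?_⟩
    exact hA.not_mem_branch hvd (hsub (mem_branch_self _ _))) hvd (hle d hd) rfl
  have hSe : ∀ c ∈ S.erase d, T.Adj v c := fun c hc => (hS c (mem_of_mem_erase hc)).1
  have hrec' : ∀ c ∈ S.erase d, ∃ L, Refines (residual T B v c) Set.univ L ∧
      2 ^ (B v).card * cost Q L ≤ Λ * (beyond T B Q v c).card ^ 3 := fun c hc =>
    hrec v c (hSe c hc) (hle c (mem_of_mem_erase hc))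
  have hdd : ∀ c ∈ S.erase d, ∀ t ∈ T.branch v d, t ∉ T.branch v c := fun c hc t ht ht' =>
    hA.disjoint_branch hvd (hSe c hc) (ne_of_mem_erase hc).symm ht ht'
  have hsep : ∀ t ∈ T.branch v d, ∀ t' ∉ T.branch v d, ∀ w ∈ B t, w ∈ B t' → w ∈ B v :=
    fun t ht t' ht' w hw hw' => (hB hvd ht ht' hw hw').1
  have hin : ∀ M, Refines B (T.branch v d) M → ∀ w ∈ support M, w ∈ B v → w ∈ B d := by
    intro M hM w hw hwv
    obtain ⟨t, ht, hwt⟩ := hM.exists_mem w hw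
    exact (hB hvd ht (hA.not_mem_branch hvd) hwt hwv).2
  have hset : ∀ t, t ∈ T.branch u v ↔
      t ∈ T.branch v d ∨ t = v ∨ ∃ c ∈ S.erase d, t ∈ T.branch v c := by
    intro t
    rw [hbr]
    constructor
    · rintro (rfl | ⟨c, hc, htc⟩)
      · exact Or.inr (Or.inl rfl)
      · by_cases hcd : c = d
        · exact Or.inl (hcd ▸ htc)
        · exact Or.inr (Or.inr ⟨c, mem_erase.2 ⟨hcd, hc⟩, htc⟩)
    · rintro (ht | rfl | ⟨c, hc, htc⟩)
      · exact Or.inr ⟨d, hd, ht⟩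
      · exact Or.inl rfl
      · exact Or.inr ⟨c, mem_of_mem_erase hc, htc⟩
  refine ⟨G + Λ * ∑ c ∈ S.erase d, (beyond T B Q v c).card ^ 3, ?_, ?_, ?_⟩
  · have h₁ := cube_add_seven_mul_sum_cube_le (S.erase d) (fun c => (beyond T B Q v c).card)
      (beyond T B Q v d).card fun c hc => hmax c (mem_of_mem_erase hc)
    have h₂ : (beyond T B Q v d).card + ∑ c ∈ S.erase d, (beyond T B Q v c).card ≤
        (beyond T B Q u v).card := by
      rw [add_sum_erase S (fun c => (beyond T B Q v c).card) hd]
      exact sum_card_beyond_le hB hA (fun c hc => (hS c hc).1) fun c hc =>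
        beyond_subset hB hA h (hS c hc).1 (hS c hc).2
    have h₃ := Nat.mul_le_mul_left Λ (h₁.trans (Nat.pow_le_pow_left h₂ 3))
    rw [mul_add, ← mul_assoc, mul_comm Λ 7, mul_assoc] at h₃
    omega
  · obtain ⟨M, hM, -, hMl, hMc⟩ := exists_refines_glue hB hA hSe hrec' (hK v) hL refines_empty
      (fun w hw hwv => hLl w (hin L hL w hw hwv)) (by simp) hsep (by simp) (by simp) (by simp)
      hdd (by simp) hLc hnil
    refine ⟨M, ?_, hMl rfl, by simpa using hMc⟩
    convert hM using 1
    ext t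
    simp only [hset, Set.mem_union, Set.mem_iUnion, Set.mem_singleton_iff,
      Set.mem_empty_iff_false, exists_prop]
    generalize (∃ c ∈ S.erase d, t ∈ T.branch v c) = p
    clear * -
    tauto
  · obtain ⟨M, hM, hMh, -, hMc⟩ := exists_refines_glue hB hA hSe hrec' (hK v) refines_empty hR
      (by simp) (fun w hw hwv => hRh w (hin R hR w hw hwv)) (by simp) hsep
      (hA.not_mem_branch hvd) (by simp) (by simp) hdd hnil hRc
    refine ⟨M, ?_, hMh rfl, by simpa using hMc⟩
    convert hM using 1
    ext t
    simp only [hset, Set.mem_union, Set.mem_iUnion, Set.mem_singleton_iff,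
      Set.mem_empty_iff_false, exists_prop]
    generalize (∃ c ∈ S.erase d, t ∈ T.branch v c) = p
    clear * -
    tauto

/-- Otherwise every node has an edge with more than half of the elements beyond it. Following these
edges never turns back, as the elements beyond the two sides of an edge are disjoint, so the
branches shrink forever. -/
theorem exists_centroid [Fintype N] (hT : T.IsTree) (hB : Separates T B) {m : ℕ}
    (hm : (occurring B Q).card ≤ m) :
    ∃ z, ∀ c, T.Adj z c → 2 * (beyond T B Q z c).card ≤ m := by
  have hA := hT.isAcyclic
  by_contra! hcon
  suffices H : ∀ n u v, T.Adj u v → m < 2 * (beyond T B Q u v).card →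
      (T.branch u v).ncard = n → False by
    obtain ⟨z⟩ := hT.connected.nonempty
    obtain ⟨c, hc, hc'⟩ := hcon z
    exact H _ z c hc hc' rfl
  intro n
  induction n using Nat.strong_induction_on with
  | _ n ih =>
  intro u v h hw hn
  obtain ⟨c, hc, hc'⟩ := hcon v
  have hcu : c ≠ u := by
    rintro rfl
    have := card_beyond_add_card_beyond_le hB hA h hm
    omega
  refine ih _ ?_ v c hc hc' rfl
  rw [← hn]
  refine Set.ncard_lt_ncard ⟨hA.branch_subset h hc hcu, fun hsub => ?_⟩
  exact hA.not_mem_branch hc (hsub (mem_branch_self _ _))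

end

end BagList

/-! ### The cubic inequality and the recursion -/

namespace BagList

open Finset SimpleGraph

open scoped Classical

section

variable {N W : Type*} {T : SimpleGraph N} {B : N → Finset W} {Q : Finset W}

/-- The left side is convex in `a`, so it suffices to check `a = b` (`hp₁`) and `a = m / 2` (`hp₂`).
-/
theorem eight_mul_cubic_le {a b m : ℝ} (hb : 0 ≤ b) (hba : b ≤ a) (ham : 2 * a ≤ m) :
    8 * (a ^ 3 + b ^ 3 + 7 * (b ^ 2 * (m - a - b))) ≤ 3 * m ^ 3 := by
  have hm : 0 ≤ m := by linarith
  -- Up to the factor 12 this is `12 * b ^ 3 - 7 * b ^ 2 * m` minus its minimum over `b ≥ 0`,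
  -- attained at `b = 7 / 18 * m`.
  have hq : 0 ≤ (b - 7 / 18 * m) ^ 2 * (b + 7 / 36 * m) := by positivity
  have hm3 : 0 ≤ m ^ 3 := by positivity
  have hp₁ : 0 ≤ 3 / 8 * m ^ 3 - 7 * b ^ 2 * m + 12 * b ^ 3 := by nlinarith
  have hp₂ : 0 ≤ m ^ 3 / 4 - 7 / 2 * b ^ 2 * m + 6 * b ^ 3 := by nlinarith
  rcases eq_or_lt_of_le (show b ≤ m / 2 by linarith) with h | h
  · obtain rfl : a = b := by linarith
    nlinarith
  · have h₁ : 0 ≤ (a - b) * (m / 2 - a) * (a + b + m / 2) := by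
      refine mul_nonneg (mul_nonneg ?_ ?_) ?_ <;> linarith
    have h₂ := mul_nonneg (show 0 ≤ m / 2 - a by linarith) hp₁
    have h₃ := mul_nonneg (show 0 ≤ a - b by linarith) hp₂
    have h₄ := mul_nonneg (show 0 ≤ m / 2 - b by linarith) h₁
    refine le_of_mul_le_mul_left ?_ (show 0 < m / 2 - b by linarith)
    linarith

theorem eight_mul_sum_cubes_le {ι : Type*} (S : Finset ι) (f : ι → ℕ) {a b m : ℕ} (hba : b ≤ a)
    (ham : 2 * a ≤ m) (h : ∀ i ∈ S, f i ≤ b) (hs : a + b + ∑ i ∈ S, f i ≤ m) :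
    8 * (a ^ 3 + b ^ 3 + 7 * ∑ i ∈ S, f i ^ 3) ≤ 3 * m ^ 3 := by
  have h₁ : ∑ i ∈ S, f i ^ 3 ≤ b ^ 2 * ∑ i ∈ S, f i := by
    rw [mul_sum]
    refine sum_le_sum fun i hi => ?_
    rw [pow_succ]
    exact Nat.mul_le_mul_right _ (Nat.pow_le_pow_left (h i hi) 2)
  generalize ∑ i ∈ S, f i ^ 3 = p at *
  generalize ∑ i ∈ S, f i = s at *
  have h₂ := eight_mul_cubic_le (a := a) (b := b) (m := m) (by positivity) (by exact_mod_cast hba)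
    (by exact_mod_cast ham)
  have h₃ : (p : ℝ) ≤ b ^ 2 * s := by exact_mod_cast h₁
  have h₄ : (b : ℝ) ^ 2 * s ≤ b ^ 2 * (m - a - b) := by
    have : (a : ℝ) + b + s ≤ m := by exact_mod_cast hs
    gcongr
    linarith
  have : (8 * (a ^ 3 + b ^ 3 + 7 * p) : ℝ) ≤ 3 * m ^ 3 := by linarith
  exact_mod_cast this

theorem occurring_residual (u v : N) :
    occurring (residual T B u v) Q = beyond T B Q u v := by
  ext x
  simp only [mem_occurring, mem_beyond, mem_residual]
  constructor
  · rintro ⟨hQ, t, ht, hx, hu⟩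
    exact ⟨hQ, hu, t, ht, hx⟩
  · rintro ⟨hQ, hu, t, ht, hx⟩
    exact ⟨hQ, t, ht, hx, hu⟩

/-- The two heaviest branches at the centroid become spines on either side of its bag, and all
others are light. The spines contribute `Λ / 7` times a cube each, the light branches `Λ` times
theirs, whence 56. -/
theorem exists_refines_centroid [Fintype N] (hT : T.IsTree) (hB : Separates T B) {Λ K m : ℕ}
    (hK : ∀ t, 2 ^ (B t).card ≤ K) (hm : (occurring B Q).card = m)
    (hrec : ∀ z c, T.Adj z c → 2 * (beyond T B Q z c).card ≤ m →
      ∃ L, Refines (residual T B z c) Set.univ L ∧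
        2 ^ (B z).card * cost Q L ≤ Λ * (beyond T B Q z c).card ^ 3) :
    ∃ L G, Refines B Set.univ L ∧ 56 * G ≤ 3 * (Λ * m ^ 3) ∧ CostLE Q K G L := by
  have hA := hT.isAcyclic
  obtain ⟨z, hz⟩ := exists_centroid hT hB hm.le
  set S : Finset N := {c | T.Adj z c}
  have hS : ∀ c ∈ S, T.Adj z c := fun c hc => (mem_filter.1 hc).2
  have hbr : ∀ t, t = z ∨ ∃ c ∈ S, t ∈ T.branch z c := by
    intro t
    by_cases htz : t = z
    · exact Or.inl htz
    · obtain ⟨c, hc, htc⟩ := hT.connected.exists_mem_branch htz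
      exact Or.inr ⟨c, mem_filter.2 ⟨mem_univ _, hc⟩, htc⟩
  have hnil : CostLE Q K 0 ([] : List (Finset W)) := by intro Q' _; simp
  have hsum : ∑ c ∈ S, (beyond T B Q z c).card ≤ m := by
    rw [← hm]
    refine sum_card_beyond_le hB hA hS fun c _ x hx => ?_
    obtain ⟨hxQ, -, t, -, hxt⟩ := mem_beyond.1 hx
    exact mem_occurring.2 ⟨hxQ, t, hxt⟩
  have hdd : ∀ c ∈ S, ∀ d ∈ S, c ≠ d → ∀ t ∈ T.branch z d, t ∉ T.branch z c :=
    fun c hc d hd hne t ht ht' => hA.disjoint_branch (hS d hd) (hS c hc) hne.symm ht ht'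
  have hsep : ∀ d ∈ S, ∀ t ∈ T.branch z d, ∀ t' ∉ T.branch z d, ∀ w ∈ B t, w ∈ B t' → w ∈ B z :=
    fun d hd t ht t' ht' w hw hw' => (hB (hS d hd) ht ht' hw hw').1
  have hin : ∀ d ∈ S, ∀ M, Refines B (T.branch z d) M → ∀ w ∈ support M, w ∈ B z → w ∈ B d := by
    intro d hd M hM w hw hwz
    obtain ⟨t, ht, hwt⟩ := hM.exists_mem w hw
    exact (hB (hS d hd) ht (hA.not_mem_branch (hS d hd)) hwt hwz).2
  rcases S.eq_empty_or_nonempty with hSe | hSn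
  · obtain ⟨M, hM, -, -, hMc⟩ := exists_refines_glue (S := ∅) (z := z) (Λ := Λ) hB hA (by simp)
      (by simp) (hK z) (refines_empty (B := B)) refines_empty (by simp) (by simp) (by simp)
      (by simp) (by simp) (by simp) (by simp) (by simp) hnil hnil
    refine ⟨M, 0, ?_, by simp, by simpa using hMc⟩
    convert hM using 1
    ext t
    have := hbr t
    simp only [hSe, notMem_empty, false_and, exists_false, or_false] at this
    simp [this]
  obtain ⟨d, hd, hdmax⟩ := S.exists_max_image (fun c => (beyond T B Q z c).card) hSn
  obtain ⟨G₁, hG₁, ⟨L, hL, hLl, hLc⟩, -⟩ :=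
    exists_refines_branch hT hB hK hrec (hS d hd) (hz d (hS d hd))
  have hsum₁ := add_sum_erase S (fun c => (beyond T B Q z c).card) hd
  rcases (S.erase d).eq_empty_or_nonempty with hSe | hSn'
  · obtain ⟨M, hM, -, -, hMc⟩ := exists_refines_glue (S := ∅) (z := z) (Λ := Λ) hB hA (by simp)
      (by simp) (hK z) hL refines_empty (fun w hw hwz => hLl w (hin d hd L hL w hw hwz))
      (by simp) (hsep d hd) (by simp) (by simp) (by simp) (by simp) (by simp) hLc hnil
    refine ⟨M, G₁, ?_, ?_, by simpa using hMc⟩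
    · convert hM using 1
      ext t
      rcases hbr t with rfl | ⟨c, hc, htc⟩
      · simp
      · obtain rfl : c = d := by
          by_contra hne
          exact notMem_empty c (hSe ▸ mem_erase.2 ⟨hne, hc⟩)
        simp [htc]
    · have h := eight_mul_sum_cubes_le (∅ : Finset N) (fun _ => 0) (b := 0) (Nat.zero_le _)
        (hz d (hS d hd)) (by simp) (by simp; linarith [hz d (hS d hd)])
      have := Nat.mul_le_mul_left Λ h
      simp only [sum_empty] at this
      nlinarith
  obtain ⟨e, he, hemax⟩ :=
    (S.erase d).exists_max_image (fun c => (beyond T B Q z c).card) hSn'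
  have heS := mem_of_mem_erase he
  have hed := ne_of_mem_erase he
  obtain ⟨G₂, hG₂, -, ⟨R, hR, hRh, hRc⟩⟩ :=
    exists_refines_branch hT hB hK hrec (hS e heS) (hz e (hS e heS))
  have hsum₂ := add_sum_erase (S.erase d) (fun c => (beyond T B Q z c).card) he
  have hmem : ∀ c ∈ (S.erase d).erase e, c ∈ S ∧ c ≠ d ∧ c ≠ e := fun c hc =>
    ⟨mem_of_mem_erase (mem_of_mem_erase hc), ne_of_mem_erase (mem_of_mem_erase hc),
      ne_of_mem_erase hc⟩
  obtain ⟨M, hM, -, -, hMc⟩ := exists_refines_glue (S := (S.erase d).erase e) hB hA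
    (fun c hc => hS c (hmem c hc).1)
    (fun c hc => hrec z c (hS c (hmem c hc).1) (hz c (hS c (hmem c hc).1)))
    (hK z) hL hR (fun w hw hwz => hLl w (hin d hd L hL w hw hwz))
    (fun w hw hwz => hRh w (hin e heS R hR w hw hwz)) (hsep d hd) (hsep e heS)
    (hA.not_mem_branch (hS e heS)) (hdd e heS d hd hed)
    (fun c hc => hdd c (hmem c hc).1 d hd (hmem c hc).2.1)
    (fun c hc => hdd c (hmem c hc).1 e heS (hmem c hc).2.2) hLc hRc
  refine ⟨M, _, ?_, ?_, hMc⟩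
  · convert hM using 1
    ext t
    simp only [Set.mem_univ, true_iff]
    rcases hbr t with rfl | ⟨c, hc, htc⟩
    · exact Or.inl (Or.inl (Or.inr rfl))
    · by_cases hcd : c = d
      · exact Or.inl (Or.inl (Or.inl (hcd ▸ htc)))
      · by_cases hce : c = e
        · exact Or.inr (hce ▸ htc)
        · exact Or.inl (Or.inr (Set.mem_iUnion₂.2
            ⟨c, mem_erase.2 ⟨hce, mem_erase.2 ⟨hcd, hc⟩⟩, htc⟩))
  · have h := eight_mul_sum_cubes_le ((S.erase d).erase e) (fun c => (beyond T B Q z c).card)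
      (hdmax e heS) (hz d (hS d hd)) (fun c hc => hemax c (mem_of_mem_erase hc)) (by omega)
    have := Nat.mul_le_mul_left Λ h
    generalize ∑ c ∈ (S.erase d).erase e, (beyond T B Q z c).card ^ 3 = s at *
    nlinarith

/-- A tree decomposition of width at most `k`, `3 ≤ k`, is refined by a path decomposition of cost
`O(m ^ k)`, where `m` is the number of elements of `Q` that occur in it. -/
theorem exists_refines_univ [Fintype N] (hT : T.IsTree) {k : ℕ} (hk : 3 ≤ k)
    (hB : Separates T B) (hcard : ∀ t, (B t).card ≤ k + 1) :
    ∃ L, Refines B Set.univ L ∧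
      cost Q L ≤ 7 * 2 ^ (k + 1) * (occurring B Q).card ^ k := by
  induction hm : (occurring B Q).card using Nat.strong_induction_on generalizing B with
  | _ m ih =>
  rcases Nat.eq_zero_or_pos m with rfl | hpos
  -- Without elements of `Q` nothing is charged, so one bag of any size will do.
  · refine ⟨[univ.biUnion B], ⟨conv_singleton _, fun w hw => ?_, fun t _ => ?_⟩, ?_⟩
    · simpa using hw
    · exact ⟨_, by simp, subset_biUnion_of_mem B (mem_univ t)⟩
    · have : Q ∩ univ.biUnion B = ∅ := by
        rw [card_eq_zero] at hm
        rw [← hm]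
        ext x
        simp [mem_occurring]
      rw [cost_singleton, this]
      simp
  have hK : ∀ t, 2 ^ (B t).card ≤ 2 ^ (k + 1) := fun t => Nat.pow_le_pow_right two_pos (hcard t)
  obtain ⟨j, rfl⟩ := Nat.exists_eq_add_of_le hk
  -- With `k = 3 + j`, the factor `2 ^ (k + 1) = 16 * 2 ^ j` is absorbed by `(2 * w) ^ j ≤ m ^ j`,
  -- up to 16.
  obtain ⟨L, G, hL, hG, hLc⟩ := exists_refines_centroid (Q := Q)
    (Λ := 16 * (7 * 2 ^ (3 + j + 1)) * m ^ j) hT hB hK hm (by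
      intro z c hzc hw
      obtain ⟨L, hL, hLc⟩ := ih (beyond T B Q z c).card (by omega) (hB.residual hzc)
        (fun t => (card_le_card fun w hw => (mem_residual.1 hw).2.1).trans (hcard t))
        (by rw [occurring_residual])
      refine ⟨L, hL, ?_⟩
      have h₁ := Nat.mul_le_mul (hK z) hLc
      have h₂ := Nat.pow_le_pow_left hw j
      generalize (beyond T B Q z c).card = w at *
      refine h₁.trans ?_
      calc 2 ^ (3 + j + 1) * (7 * 2 ^ (3 + j + 1) * w ^ (3 + j))
          = 16 * (7 * 2 ^ (3 + j + 1)) * (2 * w) ^ j * w ^ 3 := by ring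
        _ ≤ _ := by gcongr)
  refine ⟨L, hL, (hLc Q subset_rfl).trans ?_⟩
  have h₁ : (Q ∩ support L).card ≤ m := by
    rw [← hm]
    refine card_le_card fun x hx => ?_
    obtain ⟨t, -, ht⟩ := hL.exists_mem x (mem_inter.1 hx).2
    exact mem_occurring.2 ⟨(mem_inter.1 hx).1, t, ht⟩
  have h₂ : m ≤ m ^ (3 + j) := Nat.le_self_pow (by omega) m
  have h₃ := Nat.mul_le_mul_left (2 ^ (3 + j + 1)) (h₁.trans h₂)
  -- As `336 = 6 * 56`, the light branches take 6 of the 7 units `2 ^ (k + 1) * m ^ k`, and `h₃`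
  -- gives the last one to the spines.
  have h₄ : 3 * (16 * (7 * 2 ^ (3 + j + 1)) * m ^ j * m ^ 3) =
      336 * (2 ^ (3 + j + 1) * m ^ (3 + j)) := by ring
  have h₅ : 7 * 2 ^ (3 + j + 1) * m ^ (3 + j) = 7 * (2 ^ (3 + j + 1) * m ^ (3 + j)) := by ring
  omega

end

end BagList

/-! ### The canonical diagram of a variable order -/

namespace CNF

open scoped Classical

variable {V : Type u} [Fintype V]

/-- The subfunction of `F` after the variables at positions below `j` are set according to `σ`. -/
def subfunction (F : CNF V) (e : V ≃ Fin (Fintype.card V)) (j : ℕ) (σ τ : V → Bool) : Prop :=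
  F.Sat fun x => if (e x : ℕ) < j then σ x else τ x

theorem subfunction_update (F : CNF V) (e : V ≃ Fin (Fintype.card V)) (j : Fin (Fintype.card V))
    (b : Bool) (σ τ : V → Bool) :
    F.subfunction e j σ (Function.update τ (e.symm j) b) =
      F.subfunction e (j + 1) (Function.update σ (e.symm j) b) τ := by
  unfold subfunction
  congr 1
  funext x
  by_cases hx : x = e.symm j
  · subst hx
    simp
  · have hne : (e x : ℕ) ≠ j := fun h => hx (by rw [← Fin.ext h, Equiv.symm_apply_apply])
    have : (e x : ℕ) < j ↔ (e x : ℕ) < j + 1 := by omega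
    simp [Function.update_of_ne hx, this]

/-- The states of the canonical diagram: the subfunctions at each level. -/
abbrev CanonicalNode (F : CNF V) (e : V ≃ Fin (Fintype.card V)) : Type u :=
  Σ j : Fin (Fintype.card V), Set.range (F.subfunction e j)

variable (F : CNF V) (e : V ≃ Fin (Fintype.card V))

/-- The canonical state at level `j` reached under the assignment `σ`. -/
noncomputable def canonicalState (j : ℕ) (σ : V → Bool) : CanonicalNode F e ⊕ Bool :=
  if h : j < Fintype.card V then .inl ⟨⟨j, h⟩, F.subfunction e j σ, σ, rfl⟩
  else .inr (decide (F.Sat σ))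

theorem canonicalState_of_lt {j : ℕ} (h : j < Fintype.card V) (σ : V → Bool) :
    canonicalState F e j σ = .inl ⟨⟨j, h⟩, F.subfunction e j σ, σ, rfl⟩ :=
  dif_pos h

/-- The state after the variable of the node `v` is set to `b`. -/
noncomputable def canonicalChild (v : CanonicalNode F e) (b : Bool) : CanonicalNode F e ⊕ Bool :=
  canonicalState F e (v.1 + 1) (Function.update v.2.2.choose (e.symm v.1) b)

theorem canonicalState_congr {j : ℕ} {σ σ' : V → Bool}
    (h : F.subfunction e j σ = F.subfunction e j σ') :
    canonicalState F e j σ = canonicalState F e j σ' := by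
  unfold canonicalState
  split_ifs with hj
  · simp only [h]
  · have hlt : ∀ x, (e x : ℕ) < j := fun x => (e x).2.trans_le (not_lt.1 hj)
    have := congrFun h σ
    simp only [subfunction, hlt, if_true] at this
    simp only [this]

/-- The child does not depend on the assignment chosen to represent the subfunction. -/
theorem canonicalChild_state {j : ℕ} (hj : j < Fintype.card V) (σ : V → Bool) (b : Bool) :
    canonicalChild F e ⟨⟨j, hj⟩, F.subfunction e j σ, σ, rfl⟩ b =
      canonicalState F e (j + 1) (Function.update σ (e.symm ⟨j, hj⟩) b) := by
  refine canonicalState_congr F e ?_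
  generalize_proofs h
  have hc : F.subfunction e j h.choose = F.subfunction e j σ := h.choose_spec
  funext τ
  have h₁ := subfunction_update F e ⟨j, hj⟩ b h.choose τ
  have h₂ := subfunction_update F e ⟨j, hj⟩ b σ τ
  simp only at h₁ h₂ ⊢
  rw [← h₁, ← h₂, hc]

/-- The canonical diagram of `F` for the order `e`. -/
noncomputable def canonicalOBDD : OBDD V where
  Node := CanonicalNode F e
  fintypeNode := Fintype.ofFinite _
  label v := e.symm v.1
  child := canonicalChild F e
  root := canonicalState F e 0 fun _ => false
  order := e
  ordered := by
    intro v w b h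
    unfold canonicalChild canonicalState at h
    split_ifs at h with hj
    rw [← Sum.inl.inj h]
    simp [Fin.lt_def]
  reachable := by
    suffices H : ∀ (j : ℕ) (σ : V → Bool), j ≤ Fintype.card V →
        Relation.ReflTransGen (fun s t => ∃ w b, s = .inl w ∧ t = canonicalChild F e w b)
          (canonicalState F e 0 fun _ => false) (canonicalState F e j σ) by
      rintro ⟨⟨j, hj⟩, _, σ, rfl⟩
      have := H j σ hj.le
      rwa [canonicalState_of_lt F e hj] at this
    intro j
    induction j with
    | zero =>
      intro σ _
      rw [canonicalState_congr F e (σ' := σ) (by funext τ; simp [subfunction])]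
    | succ j ih =>
      intro σ hj
      refine (ih σ (by omega)).tail ⟨⟨⟨j, hj⟩, F.subfunction e j σ, σ, rfl⟩,
        σ (e.symm ⟨j, hj⟩), ?_, ?_⟩
      · exact canonicalState_of_lt F e hj σ
      · rw [canonicalChild_state, Function.update_eq_self]

theorem leads_inl {Z : OBDD V} {σ : V → Bool} {v : Z.Node} {b : Bool} :
    Z.Leads σ (.inl v) b ↔ Z.Leads σ (Z.child v (σ (Z.label v))) b :=
  ⟨fun h => by cases h; assumption, .step v b⟩

theorem leads_inr {Z : OBDD V} {σ : V → Bool} {a b : Bool} :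
    Z.Leads σ (.inr a) b ↔ a = b :=
  ⟨fun h => by cases h; rfl, fun h => h ▸ .leaf a⟩

theorem canonicalOBDD_represents : (canonicalOBDD F e).Represents F := by
  intro σ
  have hroot : (canonicalOBDD F e).root = canonicalState F e 0 σ :=
    canonicalState_congr F e (by funext τ; simp [subfunction])
  rw [hroot]
  have H : ∀ d j, j + d = Fintype.card V →
      ((canonicalOBDD F e).Leads σ (canonicalState F e j σ) true ↔ F.Sat σ) := by
    intro d
    induction d with
    | zero =>
      intro j hj
      rw [canonicalState, dif_neg (by omega)]
      exact leads_inr.trans (by simp)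
    | succ d ih =>
      intro j hj
      rw [← ih (j + 1) (by omega)]
      have hlt : j < Fintype.card V := by omega
      have h := canonicalChild_state F e hlt σ (σ (e.symm ⟨j, hlt⟩))
      rw [Function.update_eq_self] at h
      rw [← h, canonicalState_of_lt F e hlt]
      exact leads_inl
  exact H _ 0 (zero_add _)

theorem canonicalOBDD_size_le {b : Fin (Fintype.card V) → ℕ}
    (hb : ∀ j : Fin (Fintype.card V), (Set.range (F.subfunction e j)).ncard ≤ b j) :
    (canonicalOBDD F e).size ≤ ∑ j, b j + 2 := by
  have : Fintype.card (canonicalOBDD F e).Node = Nat.card (CanonicalNode F e) := by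
    rw [Nat.card_eq_fintype_card]
    exact Fintype.card_congr (Equiv.refl _)
  rw [OBDD.size, this, Nat.card_sigma]
  exact Nat.add_le_add_right (Finset.sum_le_sum fun j _ => hb j) 2

end CNF

/-! ### From a path decomposition to a diagram -/

namespace BagList

open scoped Classical

theorem cost_eq_sum {W : Type*} {Q : Finset W} {L : List (Finset W)} (h : Q ⊆ support L) :
    cost Q L = ∑ x ∈ Q, 2 ^ (first L x).card := by
  rw [cost, Finset.inter_eq_left.2 h]

/-- The position of the first bag that contains `x`. -/
noncomputable def rank {W : Type*} : List (Finset W) → W → ℕ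
  | [], _ => 0
  | Y :: L, x => if x ∈ Y then 0 else rank L x + 1

theorem rank_append_lt {W : Type*} {L₁ L₂ : List (Finset W)} {x : W} (h : x ∈ support L₁) :
    rank (L₁ ++ L₂) x < L₁.length := by
  induction L₁ with
  | nil => simp at h
  | cons Y L ih =>
    by_cases hx : x ∈ Y
    · simp [rank, hx]
    · simpa [rank, hx] using ih (by simpa [hx] using h)

theorem rank_append {W : Type*} {L₁ L₂ : List (Finset W)} {x : W} (h : x ∉ support L₁) :
    rank (L₁ ++ L₂) x = L₁.length + rank L₂ x := by
  induction L₁ with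
  | nil => simp
  | cons Y L ih =>
    simp only [support_cons, Finset.mem_union, not_or] at h
    simp only [List.cons_append, rank, h.1, if_false, ih h.2, List.length_cons]
    omega

end BagList

theorem exists_equiv_fin_monotone {V : Type*} [Fintype V] (r : V → ℕ) :
    ∃ e : V ≃ Fin (Fintype.card V), ∀ x y, e x ≤ e y → r x ≤ r y := by
  let e₀ := Fintype.equivFin V
  let s := Tuple.sort (r ∘ e₀.symm)
  refine ⟨e₀.trans s.symm, fun x y h => ?_⟩
  simpa [s] using Tuple.monotone_sort (r ∘ e₀.symm) h

theorem ncard_range_le_of_factorsThrough {α β γ : Type*} [Finite α] {g : α → γ} {f : α → β}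
    (h : ∀ a b, f a = f b → g a = g b) : (Set.range g).ncard ≤ (Set.range f).ncard := by
  rcases isEmpty_or_nonempty α with hα | ⟨⟨a⟩⟩
  · rw [Set.range_eq_empty, Set.ncard_empty]
    exact Nat.zero_le _
  · have hf : g.FactorsThrough f := fun a b => h a b
    rw [← hf.extend_comp (fun _ => g a), Set.range_comp]
    exact Set.ncard_image_le (Set.finite_range f)

namespace CNF

open scoped Classical

open BagList

variable {V : Type u} [Fintype V]

/-- A clause outside `Y` is either fully read, hence satisfied unless already falsified, or has all
its read variables in `Y`, so their values decide it. The `+ 1` is the state with a falsified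
clause. -/
theorem ncard_range_subfunction_le {F : CNF V} {e : V ≃ Fin (Fintype.card V)} {j : ℕ}
    {Y : Finset (V ⊕ {C : Clause V // C ∈ F})}
    (h : ∀ c : {C : Clause V // C ∈ F}, .inr c ∉ Y → (∀ x, Occurs x c.1 → (e x : ℕ) < j) ∨
      ∀ x, Occurs x c.1 → (e x : ℕ) < j → .inl x ∈ Y) :
    (Set.range (F.subfunction e j)).ncard ≤ 2 ^ Y.card + 1 := by
  let P (σ : V → Bool) : V ⊕ {C : Clause V // C ∈ F} → Prop :=
    Sum.elim (fun x => (e x : ℕ) < j ∧ σ x = true)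
      (fun c => ∃ l ∈ c.1, (e l.1 : ℕ) < j ∧ σ l.1 = l.2)
  let bad (σ : V → Bool) : Prop := ∃ C ∈ F, ∀ l ∈ C, (e l.1 : ℕ) < j ∧ σ l.1 ≠ l.2
  let state (σ : V → Bool) : Option (Finset (V ⊕ {C : Clause V // C ∈ F})) :=
    if bad σ then none else some (Y.filter (P σ))
  have hbad : ∀ σ τ, bad σ → ¬ F.subfunction e j σ τ := by
    rintro σ τ ⟨C, hC, hl⟩ hs
    obtain ⟨l, hlC, h'⟩ := hs C hC
    simp only [(hl l hlC).1, if_true] at h'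
    exact (hl l hlC).2 h'
  have himp : ∀ σ σ', ¬ bad σ' → Y.filter (P σ) = Y.filter (P σ') → ∀ τ,
      F.subfunction e j σ τ → F.subfunction e j σ' τ := by
    intro σ σ' hb hY τ hs C hC
    have hP : ∀ w ∈ Y, (P σ w ↔ P σ' w) := fun w hw => by
      simpa [hw] using Finset.ext_iff.1 hY w
    obtain ⟨l, hl, hlσ⟩ := hs C hC
    by_cases hlj : (e l.1 : ℕ) < j
    · simp only [hlj, if_true] at hlσ
      by_cases hcY : (.inr ⟨C, hC⟩ : V ⊕ {C : Clause V // C ∈ F}) ∈ Y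
      · obtain ⟨l', hl', hj', he'⟩ := (hP _ hcY).1 ⟨l, hl, hlj, hlσ⟩
        exact ⟨l', hl', by simpa [hj'] using he'⟩
      · rcases h ⟨C, hC⟩ hcY with hall | hin
        · by_contra! hcon
          refine hb ⟨C, hC, fun l' hl' => ?_⟩
          have hj' := hall l'.1 ⟨l'.2, hl'⟩
          exact ⟨hj', by simpa [hj'] using hcon l' hl'⟩
        · have := hP _ (hin l.1 ⟨l.2, hl⟩ hlj)
          simp only [P, Sum.elim_inl, hlj, true_and] at this
          refine ⟨l, hl, ?_⟩
          simp only [hlj, if_true]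
          rw [← hlσ]
          exact (Bool.eq_iff_iff.2 this).symm
    · exact ⟨l, hl, by simpa [hlj] using hlσ⟩
  have hstate : ∀ σ σ', state σ = state σ' → F.subfunction e j σ = F.subfunction e j σ' := by
    intro σ σ' hs
    funext τ
    by_cases hb : bad σ <;> by_cases hb' : bad σ' <;> simp only [state, hb, hb', if_true,
      if_false, reduceCtorEq, Option.some.injEq] at hs
    · exact propext ⟨fun h => absurd h (hbad σ τ hb), fun h => absurd h (hbad σ' τ hb')⟩
    · exact propext ⟨himp σ σ' hb' hs τ, himp σ' σ hb hs.symm τ⟩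
  refine (ncard_range_le_of_factorsThrough hstate).trans ?_
  have hsub : Set.range state ⊆ (Finset.insertNone Y.powerset : Finset _) := by
    rintro _ ⟨σ, rfl⟩
    simp only [state]
    split_ifs <;> simp
  refine (Set.ncard_le_ncard hsub (Finset.finite_toSet _)).trans ?_
  rw [Set.ncard_coe_finset, Finset.card_insertNone, Finset.card_powerset]

theorem exists_OBDD_of_bagList {F : CNF V} {L : List (Finset (V ⊕ {C : Clause V // C ∈ F}))}
    (hL : Conv L) (hvar : ∀ x, .inl x ∈ support L)
    (hedge : ∀ x (c : {C : Clause V // C ∈ F}), Occurs x c.1 →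
      ∃ Y ∈ L, .inl x ∈ Y ∧ .inr c ∈ Y) :
    ∃ Z : OBDD V, Z.Represents F ∧
      Z.size ≤ 2 * cost (Finset.univ.map Function.Embedding.inl) L + 2 := by
  obtain ⟨e, he⟩ := exists_equiv_fin_monotone fun x : V => rank L (.inl x)
  refine ⟨canonicalOBDD F e, canonicalOBDD_represents F e, ?_⟩
  refine (canonicalOBDD_size_le F e
    (b := fun j => 2 ^ (first L (.inl (e.symm j))).card + 1) fun j => ?_).trans ?_
  · refine ncard_range_subfunction_le fun c hc => ?_
    obtain ⟨L₁, L₂, hsplit, hx₁, hxY⟩ := exists_split_first (hvar (e.symm j))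
    set Y := first L (.inl (e.symm j))
    have hrx : rank L (.inl (e.symm j)) = L₁.length := by
      rw [hsplit, rank_append hx₁]
      simp [rank, hxY]
    -- A clause outside `Y` occurs only before `Y` or only after it. In the first case its variables
    -- have smaller rank and are all read; in the second, those already read also occur after `Y`,
    -- hence in `Y` by convexity.
    by_cases hc₁ : .inr c ∈ support L₁
    · left
      intro x hx
      obtain ⟨Z, hZ, hxZ, hcZ⟩ := hedge x c hx
      have hZ₁ : Z ∈ L₁ := by
        rw [hsplit] at hZ
        rcases List.mem_append.1 hZ with hZ | hZ
        · exact hZ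
        · rcases List.mem_cons.1 hZ with rfl | hZ
          · exact absurd hcZ hc
          · exact absurd (hL L₁ Y L₂ hsplit _ hc₁ (mem_support.2 ⟨Z, hZ, hcZ⟩)) hc
      have hlt := rank_append_lt (L₂ := Y :: L₂) (mem_support.2 ⟨Z, hZ₁, hxZ⟩)
      rw [← hsplit] at hlt
      by_contra hge
      have := he (e.symm j) x (by rw [Equiv.apply_symm_apply]; exact not_lt.1 hge)
      omega
    · right
      intro x hx hxj
      obtain ⟨Z, hZ, hxZ, hcZ⟩ := hedge x c hx
      have hZ₂ : Z ∈ L₂ := by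
        rw [hsplit] at hZ
        rcases List.mem_append.1 hZ with hZ | hZ
        · exact absurd (mem_support.2 ⟨Z, hZ, hcZ⟩) hc₁
        · rcases List.mem_cons.1 hZ with rfl | hZ
          · exact absurd hcZ hc
          · exact hZ
      by_cases hx' : .inl x ∈ support L₁
      · exact hL L₁ Y L₂ hsplit _ hx' (mem_support.2 ⟨Z, hZ₂, hxZ⟩)
      · by_contra hxY'
        have h₁ := he x (e.symm j) (by rw [Equiv.apply_symm_apply]; exact hxj.le)
        have h₂ : rank L (.inl x) = L₁.length + (rank L₂ (.inl x) + 1) := by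
          conv_lhs => rw [hsplit, rank_append hx']
          simp [rank, hxY']
        omega
  · have hcost : cost (Finset.univ.map Function.Embedding.inl) L =
        ∑ x, 2 ^ (first L (.inl x)).card := by
      rw [cost_eq_sum, Finset.sum_map]
      · rfl
      · intro w hw
        obtain ⟨x, -, rfl⟩ := Finset.mem_map.1 hw
        exact hvar x
    rw [hcost, Equiv.sum_comp e.symm (fun x => 2 ^ (first L (.inl x)).card + 1), Finset.mul_sum]
    gcongr with x
    have : 1 ≤ 2 ^ (first L (.inl x)).card := Nat.one_le_two_pow
    omega

end CNF

/-! ### Treewidth and the two bounds -/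

namespace SimpleGraph

theorem isTree_of_subsingleton {N : Type*} [Subsingleton N] [Nonempty N] (T : SimpleGraph N) :
    T.IsTree :=
  ⟨⟨Preconnected.of_subsingleton⟩, IsAcyclic.of_subsingleton⟩

/-- The decomposition with a single bag. -/
def TreeDecomposition.trivial {W : Type u} [Fintype W] (G : SimpleGraph W) :
    G.TreeDecomposition where
  Node := Unit
  T := ⊥
  isTree := isTree_of_subsingleton _
  bag _ := Finset.univ
  union w := ⟨(), Finset.mem_univ w⟩
  containment w w' _ := ⟨(), Finset.mem_univ w, Finset.mem_univ w'⟩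
  connectedness w :=
    haveI : Nonempty {_t : Unit | w ∈ (Finset.univ : Finset W)} := ⟨⟨(), Finset.mem_univ w⟩⟩
    isTree_of_subsingleton _

theorem exists_width_eq_treewidth {W : Type u} [Finite W] (G : SimpleGraph W) :
    ∃ D : G.TreeDecomposition, D.width = G.treewidth := by
  have := Fintype.ofFinite W
  exact Nat.sInf_mem (s := {w | ∃ D : G.TreeDecomposition, D.width = w})
    ⟨_, TreeDecomposition.trivial G, rfl⟩

theorem TreeDecomposition.card_bag_le {W : Type u} {G : SimpleGraph W} (D : G.TreeDecomposition)
    (t : D.Node) : (D.bag t).card ≤ D.width + 1 := by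
  have := Finset.le_sup (f := fun t => (D.bag t).card) (Finset.mem_univ t)
  unfold width
  omega

theorem treewidth_eq_zero_of_subsingleton {W : Type u} [Finite W] [Subsingleton W]
    (G : SimpleGraph W) : G.treewidth = 0 := by
  have := Fintype.ofFinite W
  have hle : G.treewidth ≤ (TreeDecomposition.trivial G).width :=
    Nat.sInf_le ⟨TreeDecomposition.trivial G, rfl⟩
  refine Nat.le_zero.1 (hle.trans ?_)
  have h : (Finset.univ.sup fun t => ((TreeDecomposition.trivial G).bag t).card) ≤ 1 :=
    Finset.sup_le fun t _ => Finset.card_le_one_of_subsingleton _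
  unfold TreeDecomposition.width
  omega

theorem TreeDecomposition.separates {W : Type u} {G : SimpleGraph W} (D : G.TreeDecomposition) :
    BagList.Separates D.T D.bag := fun _ _ h _ _ w ha hb hwa hwb =>
  D.isTree.isAcyclic.mem_of_preconnected_of_branch h
    (S := {t | w ∈ D.bag t}) (D.connectedness w).connected.preconnected hwa hwb ha hb

end SimpleGraph

namespace CNF

open BagList

variable {V : Type u} [Fintype V]

theorem exists_OBDD_of_treewidth_le (F : CNF V) {k : ℕ} (hk : 3 ≤ k)
    (h : F.incidenceGraph.treewidth ≤ k) :
    ∃ Z : OBDD V, Z.Represents F ∧ Z.size ≤ 14 * 2 ^ (k + 1) * Fintype.card V ^ k + 2 := by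
  obtain ⟨D, hD⟩ := F.incidenceGraph.exists_width_eq_treewidth
  obtain ⟨L, hL, hc⟩ := exists_refines_univ (Q := Finset.univ.map Function.Embedding.inl) D.isTree
    hk D.separates fun t => (D.card_bag_le t).trans (by omega)
  obtain ⟨Z, hZ, hs⟩ := exists_OBDD_of_bagList hL.conv
    (fun x => by
      obtain ⟨t, ht⟩ := D.union (.inl x)
      obtain ⟨Y, hY, htY⟩ := hL.cover t trivial
      exact mem_support.2 ⟨Y, hY, htY ht⟩)
    (fun x c hx => by
      obtain ⟨t, ht, ht'⟩ := D.containment (.inl x) (.inr c) hx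
      obtain ⟨Y, hY, htY⟩ := hL.cover t trivial
      exact ⟨Y, hY, htY ht, htY ht'⟩)
  refine ⟨Z, hZ, hs.trans ?_⟩
  have h₁ : (occurring D.bag (Finset.univ.map Function.Embedding.inl)).card ≤ Fintype.card V :=
    (Finset.card_le_card fun x hx => (mem_occurring.1 hx).1).trans (by simp)
  have h₂ := hc.trans (Nat.mul_le_mul_left (7 * 2 ^ (k + 1)) (Nat.pow_le_pow_left h₁ k))
  calc _ ≤ 2 * (7 * 2 ^ (k + 1) * Fintype.card V ^ k) + 2 := by gcongr
    _ = _ := by ring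

/-- The diagram that consists of the leaf `b`. -/
def leafOBDD (V : Type u) [Fintype V] (e : V ≃ Fin (Fintype.card V)) (b : Bool) : OBDD V where
  Node := PEmpty
  label := PEmpty.elim
  child := fun v => v.elim
  root := .inr b
  order := e
  ordered := fun v => v.elim
  reachable := fun v => v.elim

/-- Bags with at most one element contain no edge, so every clause is empty and `F` is constant. -/
theorem exists_OBDD_of_treewidth_eq_zero (F : CNF V) (h : F.incidenceGraph.treewidth = 0) :
    ∃ Z : OBDD V, Z.Represents F ∧ Z.size = 2 := by
  classical
  obtain ⟨D, hD⟩ := F.incidenceGraph.exists_width_eq_treewidth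
  have hno : ∀ C ∈ F, ∀ l, l ∉ C := by
    intro C hC l hl
    obtain ⟨t, ht, ht'⟩ := D.containment (.inl l.1) (.inr ⟨C, hC⟩) ⟨l.2, hl⟩
    have hcard := D.card_bag_le t
    rw [hD, h] at hcard
    exact Sum.inl_ne_inr (Finset.card_le_one.1 hcard _ ht _ ht')
  have hsat : ∀ σ, F.Sat σ ↔ F = ∅ := by
    intro σ
    refine ⟨fun hs => Finset.eq_empty_of_forall_notMem fun C hC => ?_, ?_⟩
    · obtain ⟨l, hl, -⟩ := hs C hC
      exact hno C hC l hl
    · rintro rfl C hC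
      simp at hC
  refine ⟨leafOBDD V (Fintype.equivFin V) (decide (F = ∅)), fun σ => ?_, ?_⟩
  · rw [hsat]
    exact leads_inr.trans (by simp)
  · exact congrArg (· + 2) (Fintype.card_eq_zero (α := PEmpty))

theorem treewidth_eq_zero_of_card_eq_zero (F : CNF V) (h : Fintype.card V = 0) :
    F.incidenceGraph.treewidth = 0 := by
  have := Fintype.card_eq_zero_iff.1 h
  have : Subsingleton (V ⊕ {C : Clause V // C ∈ F}) :=
    ⟨by
      rintro (x | c) (y | d)
      · exact isEmptyElim x
      · exact isEmptyElim x
      · exact isEmptyElim y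
      · exact congrArg _ (Subsingleton.elim c d)⟩
  exact SimpleGraph.treewidth_eq_zero_of_subsingleton _

theorem exists_OBDD_of_card_eq_one (F : CNF V) (h : Fintype.card V = 1) :
    ∃ Z : OBDD V, Z.Represents F ∧ Z.size ≤ 3 := by
  refine ⟨_, canonicalOBDD_represents F (Fintype.equivFin V), ?_⟩
  refine (canonicalOBDD_size_le F _ (b := fun _ => 1) fun j => ?_).trans (by simp [h])
  have hj : (j : ℕ) = 0 := by omega
  have hsub : (Set.range (F.subfunction (Fintype.equivFin V) j)).Subsingleton := by
    rintro _ ⟨σ, rfl⟩ _ ⟨σ', rfl⟩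
    funext τ
    simp [subfunction, hj]
  exact Set.ncard_le_one_iff_subsingleton.2 hsub

end CNF

theorem mainTheorem5 :
    (∃ c : ℕ, ∀ (V : Type u) [Fintype V] (F : CNF V) (k : ℕ), F.incidenceGraph.treewidth = k →
      ∃ Z : OBDD V, Z.Represents F ∧ Z.size ≤ c * Fintype.card V ^ (c * k)) ∧
    (∀ k : ℕ, 3 ≤ k →
      ∃ c : ℕ, ∀ (V : Type u) [Fintype V] (F : CNF V), F.incidenceGraph.treewidth = k →
        ∃ Z : OBDD V, Z.Represents F ∧ Z.size ≤ c * Fintype.card V ^ k) := by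
  constructor
  · refine ⟨114, fun V _ F k hk => ?_⟩
    rcases Nat.eq_zero_or_pos k with rfl | hkpos
    · obtain ⟨Z, hZ, hs⟩ := F.exists_OBDD_of_treewidth_eq_zero hk
      exact ⟨Z, hZ, by simp [hs]⟩
    have hn : Fintype.card V ≠ 0 := fun h => by
      have := F.treewidth_eq_zero_of_card_eq_zero h
      omega
    -- A single variable is treated apart: powers of `n = 1` cannot absorb `2 ^ k`.
    rcases (Nat.one_le_iff_ne_zero.2 hn).eq_or_lt with hn₁ | hn₂
    · obtain ⟨Z, hZ, hs⟩ := F.exists_OBDD_of_card_eq_one hn₁.symm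
      exact ⟨Z, hZ, hs.trans (by simp [← hn₁])⟩
    -- Passing to `k + 2` reaches the range of exponents from 3 on, and `2 ^ k ≤ n ^ k` removes the
    -- dependence of the constant on `k`.
    · obtain ⟨Z, hZ, hs⟩ := F.exists_OBDD_of_treewidth_le (k := k + 2) (by omega) (by omega)
      refine ⟨Z, hZ, hs.trans ?_⟩
      generalize Fintype.card V = n at *
      have h₁ : 2 ^ k ≤ n ^ k := Nat.pow_le_pow_left hn₂ k
      have h₂ : 1 ≤ n ^ (114 * k) := Nat.one_le_pow _ _ (by omega)
      calc 14 * 2 ^ (k + 2 + 1) * n ^ (k + 2) + 2 = 112 * (2 ^ k * n ^ (k + 2)) + 2 := by ring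
        _ ≤ 112 * (n ^ k * n ^ (k + 2)) + 2 := by gcongr
        _ = 112 * n ^ (2 * k + 2) + 2 := by ring
        _ ≤ 112 * n ^ (114 * k) + 2 * n ^ (114 * k) := by
          gcongr
          · omega
          · omega
          · omega
        _ = 114 * n ^ (114 * k) := by ring
  · intro k hk
    refine ⟨14 * 2 ^ (k + 1) + 2, fun V _ F hF => ?_⟩
    obtain ⟨Z, hZ, hs⟩ := F.exists_OBDD_of_treewidth_le hk hF.le
    refine ⟨Z, hZ, hs.trans ?_⟩
    have hn : Fintype.card V ≠ 0 := fun h => by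
      have := F.treewidth_eq_zero_of_card_eq_zero h
      omega
    have h₂ : 1 ≤ Fintype.card V ^ k := Nat.one_le_pow _ _ (Nat.pos_of_ne_zero hn)
    rw [add_mul]
    omega
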